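/- Let $n\in\mathbb{N}\cup\{\infty\}$. For an associative unital ring $R$, let $\mathcal{P}^{<n+1}$ be the class of left $R$-modules $M$ having an exact sequence $0\to P_k\to\cdots\to P_0\to M\to 0$ with every $P_i$ finitely generated projective and $k\le n$ finite. A short exact sequence of left $R$-modules is \emph{$n$-exact} if it stays exact under $\mathrm{Hom}_R(M,-)$ for all $M\in\mathcal{P}^{<n+1}$; a module $P$ is \emph{$n$-projective} if $\mathrm{Hom}_R(P,-)$ keeps every $n$-exact sequence exact, and $\mathcal{P}_n$ denotes the class of $n$-projective modules. A complex $X^\bullet$ is \emph{$n$-exact} if it is exact and all sequences $0\to\mathrm{Ker}\,d^i\to X^i\to\mathrm{Coker}\,d^{i-1}\to0$ are $n$-exact; a cochain map is an \emph{$n$-quasi-isomorphism} if its mapping cone is $n$-exact. Let $\boldsymbol{D}^b_n(R)=\boldsymbol{K}^b(R)/\boldsymbol{K}^b_n(R)$ be the Verdier quotient of the bounded homotopy category of left $R$-modules by the bounded $n$-exact complexes, and let $\boldsymbol{D}^b_{n\text{-}sg}(R)=\boldsymbol{D}^b_n(R)/\boldsymbol{K}^b(\mathcal{P}_n)$ be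 the Verdier quotient by (the essential image of) the bounded complexes of $n$-projective modules. For a complex $X^\bullet$ write $n\text{-}\mathrm{pd}_R X^\bullet\le m$ ($m\in\mathbb{Z}$) if there is an $n$-quasi-isomorphism $P^\bullet\to X^\bullet$, where $P^\bullet$ is a complex of $n$-projective modules, $\mathrm{Hom}_R(P^\bullet,Y^\bullet)$ is exact for every $n$-exact complex $Y^\bullet$, and $P^i=0$ for $i<-m$; let $n\text{-}\mathrm{pd}_R X^\bullet\in\mathbb{Z}\cup\{\pm\infty\}$ be the infimum of such $m$. Put $n\text{-}\mathrm{gldim}(R)=\sup\{n\text{-}\mathrm{pd}_R M\mid M \text{ a left } R\text{-module}\}$, and call it finite if it is $<\infty$ (so the value $-\infty$ for the zero ring counts as finite). A triangulated category $\mathcal{T}$ admits a \emph{recollement} relative to $\mathcal{T}'$ and $\mathcal{T}''$ if there are triangulated functors $i^*,i^!:\mathcal{T}\to\mathcal{T}'$, $i_*:\mathcal{T}'\to\mathcal{T}$, $j^*:\mathcal{T}\to\mathcal{T}''$, $j_!,j_*:\mathcal{T}''\to\mathcal{T}$ such that $(i^*,i_*),(i_*,i^!),(j_!,j^*),(j^*,j_*)$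 are adjoint pairs; $i_*,j_*,j_!$ are fully faithful; $j^*i_*=0$; and for each $X\in\mathcal{T}$ there are distinguished triangles $i_*i^!X\to X\to j_*j^*X\to i_*i^!X[1]$ and $j_!j^*X\to X\to i_*i^*X\to j_!j^*X[1]$. \textbf{Theorem.} Let $R,S,T$ be rings and suppose that $\boldsymbol{D}^b_n(R)$ admits a recollement relative to $\boldsymbol{D}^b_n(S)$ and $\boldsymbol{D}^b_n(T)$. Then $\boldsymbol{D}^b_{n\text{-}sg}(R)=0$ if and only if $\boldsymbol{D}^b_{n\text{-}sg}(S)=0=\boldsymbol{D}^b_{n\text{-}sg}(T)$. Moreover, $n\text{-}\mathrm{gldim}(R)$ is finite if and only if both $n\text{-}\mathrm{gldim}(S)$ and $n\text{-}\mathrm{gldim}(T)$ are finite. -/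

import Mathlib

open CategoryTheory CategoryTheory.Limits CategoryTheory.Pretriangulated Opposite
open scoped ZeroObject

universe u

noncomputable section

namespace NSing

section Modules

variable (R : Type u) [Ring R]

/-- `HasFGProjRes R k M`: there is an exact sequence
`0 ⟶ P_k ⟶ ⋯ ⟶ P_1 ⟶ P_0 ⟶ M ⟶ 0` with all `P_i` finitely generated projective
(built one syzygy at a time). -/
inductive HasFGProjRes : ℕ → ModuleCat.{u} R → Prop
  | zero (M : ModuleCat.{u} R) (hfin : Module.Finite R M) (hproj : Module.Projective R M) :
      HasFGProjRes 0 M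
  | succ (k : ℕ) (S : ShortComplex (ModuleCat.{u} R)) (hS : S.ShortExact)
      (hfin : Module.Finite R S.X₂) (hproj : Module.Projective R S.X₂)
      (hK : HasFGProjRes k S.X₁) : HasFGProjRes (k + 1) S.X₃

variable (n : ℕ∞)

/-- The class `𝒫^{<n+1}` of modules having a finite resolution of length at most `n` by finitely
generated projective modules; for `n = ⊤` the length is finite but arbitrary. -/
def FinProjClass : ObjectProperty (ModuleCat.{u} R) :=
  fun M => ∃ k : ℕ, (k : ℕ∞) ≤ n ∧ HasFGProjRes R k M

variable {R}

/-- The functor `Hom_R(M, -)` with values in abelian groups. -/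
abbrev homFunctor (M : ModuleCat.{u} R) : ModuleCat.{u} R ⥤ AddCommGrpCat.{u} :=
  preadditiveCoyoneda.obj (op M)

/-- `n`-exact short exact sequences of modules. -/
def NShortExact (S : ShortComplex (ModuleCat.{u} R)) : Prop :=
  S.ShortExact ∧ ∀ M : ModuleCat.{u} R, FinProjClass R n M → (S.map (homFunctor M)).ShortExact

/-- `n`-projective modules. -/
def NProjective : ObjectProperty (ModuleCat.{u} R) :=
  fun M => ∀ S : ShortComplex (ModuleCat.{u} R), NShortExact n S →
    (S.map (homFunctor M)).ShortExact

/-- A complex is `n`-exact at `i` if it is exact at `i` and the sequence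
`0 ⟶ Ker d^i ⟶ X^i ⟶ Coker d^{i-1} ⟶ 0` is `n`-exact. Here `X.cycles i = Ker d^i`,
`X.opcycles i = Coker d^{i-1}`. -/
def NExactAt (X : CochainComplex (ModuleCat.{u} R) ℤ) (i : ℤ) : Prop :=
  X.ExactAt i ∧ ∃ w : X.iCycles i ≫ X.pOpcycles i = 0, NShortExact n (ShortComplex.mk _ _ w)

/-- `n`-exact complexes. -/
def NExact (X : CochainComplex (ModuleCat.{u} R) ℤ) : Prop :=
  ∀ i, NExactAt n X i

/-- `n`-quasi-isomorphisms: cochain maps whose mapping cone is `n`-exact. -/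
def NQuasiIso {X Y : CochainComplex (ModuleCat.{u} R) ℤ} (f : X ⟶ Y) : Prop :=
  NExact n (CochainComplex.mappingCone f)

/-- `f : P ⟶ X` is an `n`-projective resolution of the complex `X`. -/
structure IsNProjResolution {P X : CochainComplex (ModuleCat.{u} R) ℤ} (f : P ⟶ X) : Prop where
  quasiIso : NQuasiIso n f
  projective : ∀ i, NProjective n (P.X i)
  hom_exact : ∀ Y : CochainComplex (ModuleCat.{u} R) ℤ, NExact n Y →
    (CochainComplex.HomComplex P Y).Acyclic

/-- The `n`-projective dimension of the complex `X` is at most `m`. -/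
def NPdLE (X : CochainComplex (ModuleCat.{u} R) ℤ) (m : ℤ) : Prop :=
  ∃ (P : CochainComplex (ModuleCat.{u} R) ℤ) (f : P ⟶ X),
    IsNProjResolution n f ∧ ∀ i : ℤ, i < -m → IsZero (P.X i)

/-- The `n`-projective dimension of a complex, an element of `{-∞} ∪ ℤ ∪ {∞}`. -/
def nPd (X : CochainComplex (ModuleCat.{u} R) ℤ) : WithBot (WithTop ℤ) :=
  ⨅ (m : ℤ) (_ : NPdLE n X m), ((m : WithTop ℤ) : WithBot (WithTop ℤ))

variable (R)

/-- The left `n`-global dimension: the supremum of the `n`-projective dimensions of all left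
modules, regarded as complexes concentrated in degree `0`. -/
def nGldim : WithBot (WithTop ℤ) :=
  ⨆ M : ModuleCat.{u} R, nPd n ((CochainComplex.singleFunctor (ModuleCat.{u} R) 0).obj M)

end Modules

section HomExact

variable {R : Type u} [Ring R] (n : ℕ∞)

/-- The complex `Hom_R(M, X)`. -/
abbrev homCx (M : ModuleCat.{u} R) (X : CochainComplex (ModuleCat.{u} R) ℤ) :
    CochainComplex AddCommGrpCat.{u} ℤ :=
  ((homFunctor M).mapHomologicalComplex (ComplexShape.up ℤ)).obj X

lemma homCx_exactAt_iff (M : ModuleCat.{u} R) (X : CochainComplex (ModuleCat.{u} R) ℤ)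
    (i j k : ℤ) (hij : i + 1 = j) (hjk : j + 1 = k) :
    (homCx M X).ExactAt j ↔
      ∀ x : M ⟶ X.X j, x ≫ X.d j k = 0 → ∃ y : M ⟶ X.X i, y ≫ X.d i j = x := by
  rw [HomologicalComplex.exactAt_iff' _ i j k (by simp; omega) (by simp; omega),
    ShortComplex.ab_exact_iff]
  exact Iff.rfl

lemma finProjClass_self : FinProjClass R n (ModuleCat.of R R) :=
  ⟨0, by simp, .zero _ (inferInstanceAs (Module.Finite R R))
    (inferInstanceAs (Module.Projective R R))⟩

/-- `n`-exactness of a complex is exactness of all complexes `Hom_R(M, X)`, `M ∈ 𝒫^{<n+1}`. -/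
lemma nExact_iff (X : CochainComplex (ModuleCat.{u} R) ℤ) :
    NExact n X ↔ ∀ M : ModuleCat.{u} R, FinProjClass R n M → (homCx M X).Acyclic := by
  constructor
  · intro h M hM j
    rw [homCx_exactAt_iff M X (j - 1) j (j + 1) (by omega) rfl]
    intro x hx
    obtain ⟨hi, w, -, hS⟩ := h (j - 1)
    obtain ⟨hj, -⟩ := h j
    have hepi := (hS M hM).epi_g
    rw [AddCommGrpCat.epi_iff_surjective] at hepi
    have e1 : Epi (X.toCycles (j - 1) j) := by
      rw [HomologicalComplex.exactAt_iff_isZero_homology] at hj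
      have hz : X.homologyπ j = 0 := hj.eq_of_tgt _ _
      have := (X.homologyIsCokernel (j - 1) j (by simp))
      exact Preadditive.epi_of_isZero_cokernel' _ this hj
    have e2 : Mono (X.fromOpcycles (j - 1) j) := by
      rw [HomologicalComplex.exactAt_iff_isZero_homology] at hi
      exact Preadditive.mono_of_isZero_kernel' _
        (X.homologyIsKernel (j - 1) j (by simp)) hi
    have e3 : Epi (X.opcyclesToCycles (j - 1) j) := by
      have : Epi (X.pOpcycles (j - 1) ≫ X.opcyclesToCycles (j - 1) j) := by
        rwa [X.pOpcycles_opcyclesToCycles]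
      exact epi_of_epi (X.pOpcycles (j - 1)) _
    have e4 : Mono (X.opcyclesToCycles (j - 1) j) := by
      have : Mono (X.opcyclesToCycles (j - 1) j ≫ X.iCycles j) := by
        rwa [X.opcyclesToCycles_iCycles]
      exact mono_of_mono _ (X.iCycles j)
    have e5 : IsIso (X.opcyclesToCycles (j - 1) j) := isIso_of_mono_of_epi _
    obtain ⟨y, hy⟩ : ∃ y : M ⟶ X.X (j - 1), y ≫ X.pOpcycles (j - 1) =
        X.liftCycles x (j + 1) (by simp) hx ≫ inv (X.opcyclesToCycles (j - 1) j) :=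
      hepi (X.liftCycles x (j + 1) (by simp) hx ≫ inv (X.opcyclesToCycles (j - 1) j))
    refine ⟨y, ?_⟩
    rw [← X.pOpcycles_opcyclesToCycles_iCycles (j - 1) j, reassoc_of% hy,
      IsIso.inv_hom_id_assoc, X.liftCycles_i]
  · intro h i
    have hex : ∀ j, X.ExactAt j := by
      intro j
      have h1 := h _ (finProjClass_self n) j
      rw [homCx_exactAt_iff _ X (j - 1) j (j + 1) (by omega) rfl] at h1
      rw [HomologicalComplex.exactAt_iff' _ (j - 1) j (j + 1) (by simp) (by simp),
        ShortComplex.moduleCat_exact_iff]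
      intro x hx
      replace hx : (X.d j (j + 1)).hom x = 0 := hx
      obtain ⟨y, hy⟩ := h1 (ModuleCat.ofHom (LinearMap.toSpanSingleton R _ x)) (by
        ext
        change (X.d j (j + 1)).hom ((1 : R) • x) = 0
        rw [one_smul, hx])
      refine ⟨y.hom (1 : R), ?_⟩
      have := congrArg (fun f => f.hom (1 : R)) hy
      exact this.trans (one_smul R x)
    have hz := (HomologicalComplex.exactAt_iff_isZero_homology _ _).1 (hex i)
    have w : X.iCycles i ≫ X.pOpcycles i = 0 := by
      rw [← X.homology_π_ι, hz.eq_of_tgt (X.homologyπ i) 0, zero_comp]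
    have e2 : Mono (X.fromOpcycles i (i + 1)) :=
      Preadditive.mono_of_isZero_kernel' _ (X.homologyIsKernel i (i + 1) (by simp)) hz
    have hexS : (ShortComplex.mk _ _ w).Exact := by
      refine ShortComplex.exact_of_f_is_kernel _ (KernelFork.IsLimit.ofι' _ _ fun {A} k hk => ?_)
      have hk' : k ≫ X.d i (i + 1) = 0 := by
        dsimp at k hk
        rw [← X.p_fromOpcycles i (i + 1), reassoc_of% hk, zero_comp]
      exact ⟨X.liftCycles k (i + 1) (by simp) hk', X.liftCycles_i _ _ _ _⟩
    refine ⟨hex i, w, ⟨hexS⟩, fun M hM => ?_⟩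
    have hepi : Epi ((ShortComplex.mk _ _ w).map (homFunctor M)).g := by
      rw [AddCommGrpCat.epi_iff_surjective]
      intro g
      change M ⟶ X.opcycles i at g
      obtain ⟨y, hy⟩ := (homCx_exactAt_iff M X i (i + 1) (i + 1 + 1) rfl rfl).1
        (h M hM (i + 1)) (g ≫ X.fromOpcycles i (i + 1)) (by simp)
      refine ⟨y, ?_⟩
      change y ≫ X.pOpcycles i = g
      rw [← cancel_mono (X.fromOpcycles i (i + 1)), Category.assoc, X.p_fromOpcycles, hy]
    have hmono : Mono ((ShortComplex.mk _ _ w).map (homFunctor M)).f :=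
      inferInstanceAs (Mono ((homFunctor M).map (X.iCycles i)))
    exact { exact := hexS.map_of_mono_of_preservesKernel _ inferInstance inferInstance }

end HomExact

section Categories

variable (R : Type u) [Ring R] (n : ℕ∞)

/-- The homotopy category `K(R)` of complexes of left `R`-modules. -/
abbrev KCat := HomotopyCategory (ModuleCat.{u} R) (ComplexShape.up ℤ)

/-- Bounded complexes. -/
def IsBounded (X : CochainComplex (ModuleCat.{u} R) ℤ) : Prop :=
  ∃ a b : ℤ, ∀ i : ℤ, i < a ∨ b < i → IsZero (X.X i)

/-- The objects of `K(R)` given by bounded complexes. -/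
def bounded : ObjectProperty (KCat R) := fun X => IsBounded R X.as

/-- The objects of `K(R)` given by `n`-exact complexes. -/
def nExact : ObjectProperty (KCat R) := fun X => NExact n X.as

instance : (bounded R).IsStableUnderShift ℤ where
  isStableUnderShiftBy m :=
    { le_shift := by
        intro X hX
        obtain ⟨K : CochainComplex _ _, rfl⟩ := X.quotient_obj_surjective
        obtain ⟨a, b, h⟩ := hX
        rw [ObjectProperty.prop_shift_iff, HomotopyCategory.shift_quotient_obj]
        exact ⟨a - m, b - m, fun i hi => h (i + m) (by omega)⟩ }

instance : (bounded R).IsTriangulated where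
  exists_zero := ⟨(HomotopyCategory.quotient _ _).obj 0,
    Functor.map_isZero _ (isZero_zero _), 0, 0, fun i _ =>
      Functor.map_isZero (HomologicalComplex.eval _ _ i) (isZero_zero _)⟩
  toIsTriangulatedClosed₂ := by
    have : (bounded R).IsTriangulatedClosed₃ :=
      { ext₃' := by
          rintro T hT ⟨a₁, b₁, h₁⟩ ⟨a₂, b₂, h₂⟩
          obtain ⟨f : T.obj₁.as ⟶ T.obj₂.as, hf⟩ :=
            (HomotopyCategory.quotient _ _).map_surjective T.mor₁
          refine ⟨(HomotopyCategory.quotient _ _).obj (CochainComplex.mappingCone f), ?_,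
            ⟨Triangle.π₃.mapIso (isoTriangleOfIso₁₂ T _ hT
              (HomotopyCategory.mappingCone_triangleh_distinguished f)
              (Iso.refl _) (Iso.refl _) (by
                change T.mor₁ ≫ 𝟙 _ = 𝟙 _ ≫ (HomotopyCategory.quotient _ _).map f
                rw [hf, Category.comp_id]
                exact (Category.id_comp _).symm))⟩⟩
          refine ⟨min (a₁ - 1) a₂, max (b₁ - 1) b₂, fun i hi => ?_⟩
          change IsZero ((CochainComplex.mappingCone f).X i)
          rw [CochainComplex.mappingCone.isZero_X_iff]
          exact ⟨h₁ _ (by omega), h₂ _ (by omega)⟩ }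
    exact .of_isTriangulatedClosed₃

lemma nExact_prop_iff (X : KCat R) : nExact R n X ↔
    ∀ M : ModuleCat.{u} R, FinProjClass R n M →
      ((HomotopyCategory.subcategoryAcyclic AddCommGrpCat.{u}).inverseImage
        ((homFunctor M).mapHomotopyCategory (ComplexShape.up ℤ))) X := by
  refine (nExact_iff n X.as).trans (forall₂_congr fun M _ => ?_)
  exact (HomotopyCategory.quotient_obj_mem_subcategoryAcyclic_iff_acyclic (homCx M X.as)).symm

instance : (nExact R n).IsClosedUnderIsomorphisms where
  of_iso e h := by
    rw [nExact_prop_iff] at h ⊢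
    exact fun M hM => ObjectProperty.prop_of_iso _ e (h M hM)

instance : (nExact R n).IsTriangulated where
  exists_zero := ⟨0, isZero_zero _, (nExact_prop_iff R n _).2 fun _ _ =>
    ObjectProperty.prop_zero _⟩
  isStableUnderShiftBy m :=
    { le_shift := fun _ hX => (nExact_prop_iff R n _).2 fun M hM =>
        ObjectProperty.le_shift _ m _ ((nExact_prop_iff R n _).1 hX M hM) }
  toIsTriangulatedClosed₂ := .mk' fun T hT h₁ h₃ => (nExact_prop_iff R n _).2 fun M hM =>
    ObjectProperty.ext_of_isTriangulatedClosed₂ _ T hT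
      ((nExact_prop_iff R n _).1 h₁ M hM) ((nExact_prop_iff R n _).1 h₃ M hM)

/-- The bounded homotopy category `K^b(R)`. -/
abbrev Kb := (bounded R).FullSubcategory

/-- The triangulated subcategory `K^b_n(R)` of `K^b(R)` of bounded `n`-exact complexes. -/
abbrev KbExact : ObjectProperty (Kb R) := (nExact R n).inverseImage (bounded R).ι

/-- The bounded `n`-derived category: the Verdier quotient `K^b(R) / K^b_n(R)`. -/
abbrev Db := (KbExact R n).trW.Localization

/-- The quotient functor `K^b(R) ⥤ D^b_n(R)`. -/
abbrev Qb : Kb R ⥤ Db R n := (KbExact R n).trW.Q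

/-- The bounded complexes of `n`-projective modules, as objects of `K^b(R)`. -/
def KbProj : ObjectProperty (Kb R) := fun X => ∀ i, NProjective n (X.obj.as.X i)

/-- The `n`-singularity category: the Verdier quotient of `D^b_n(R)` by (the essential image of)
the bounded homotopy category `K^b(𝒫_n)` of `n`-projective modules. -/
abbrev Dsg := ((KbProj R n).map (Qb R n)).trW.Localization

end Categories

section Recollement

universe v₁ v₂ v₃ u₁ u₂ u₃

variable (T' : Type u₁) [Category.{v₁} T'] [HasZeroObject T'] [HasShift T' ℤ] [Preadditive T']
  [∀ k : ℤ, (shiftFunctor T' k).Additive] [Pretriangulated T']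
  (T : Type u₂) [Category.{v₂} T] [HasZeroObject T] [HasShift T ℤ] [Preadditive T]
  [∀ k : ℤ, (shiftFunctor T k).Additive] [Pretriangulated T]
  (T'' : Type u₃) [Category.{v₃} T''] [HasZeroObject T''] [HasShift T'' ℤ] [Preadditive T'']
  [∀ k : ℤ, (shiftFunctor T'' k).Additive] [Pretriangulated T'']

/-- A recollement of the triangulated category `T` relative to `T'` and `T''`. -/
structure Recollement where
  /-- `i^*` -/
  iPull : T ⥤ T'
  /-- `i_*` -/
  iPush : T' ⥤ T
  /-- `i^!` -/
  iShriek : T ⥤ T'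
  /-- `j_!` -/
  jShriek : T'' ⥤ T
  /-- `j^*` -/
  jPull : T ⥤ T''
  /-- `j_*` -/
  jPush : T'' ⥤ T
  [iPullShift : iPull.CommShift ℤ]
  [iPushShift : iPush.CommShift ℤ]
  [iShriekShift : iShriek.CommShift ℤ]
  [jShriekShift : jShriek.CommShift ℤ]
  [jPullShift : jPull.CommShift ℤ]
  [jPushShift : jPush.CommShift ℤ]
  [iPullTri : iPull.IsTriangulated]
  [iPushTri : iPush.IsTriangulated]
  [iShriekTri : iShriek.IsTriangulated]
  [jShriekTri : jShriek.IsTriangulated]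
  [jPullTri : jPull.IsTriangulated]
  [jPushTri : jPush.IsTriangulated]
  adj₁ : iPull ⊣ iPush
  adj₂ : iPush ⊣ iShriek
  adj₃ : jShriek ⊣ jPull
  adj₄ : jPull ⊣ jPush
  iPush_full : iPush.Full
  iPush_faithful : iPush.Faithful
  jPush_full : jPush.Full
  jPush_faithful : jPush.Faithful
  jShriek_full : jShriek.Full
  jShriek_faithful : jShriek.Faithful
  /-- `j^* i_* = 0` -/
  zero (X : T') : IsZero (jPull.obj (iPush.obj X))
  triangle₁ (X : T) : ∃ (f : iPush.obj (iShriek.obj X) ⟶ X) (g : X ⟶ jPush.obj (jPull.obj X))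
    (h : jPush.obj (jPull.obj X) ⟶ (iPush.obj (iShriek.obj X))⟦(1 : ℤ)⟧),
    Triangle.mk f g h ∈ distTriang T
  triangle₂ (X : T) : ∃ (f : jShriek.obj (jPull.obj X) ⟶ X) (g : X ⟶ iPush.obj (iPull.obj X))
    (h : iPush.obj (iPull.obj X) ⟶ (jShriek.obj (jPull.obj X))⟦(1 : ℤ)⟧),
    Triangle.mk f g h ∈ distTriang T

end Recollement

end NSing

end

noncomputable section

namespace NSing

/-! ### `n`-projective modules and `n`-exact presentations. -/

section Modules

variable {R : Type u} [Ring R] (n : ℕ∞)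

/-! Vanishing of the singularity category and finiteness of the global dimension are both equivalent
to one property of `Db R n` that mentions only its triangulated structure: for all `X` and `Y`,
`Hom(X, Y[i]) = 0` once `i` is large (`eventuallyZero`). Such a property can be moved along a
recollement.

Transfer (`Recollement.eventuallyZero_iff`): it descends along `i_*` and `j_!`, which are faithful
and commute with shifts. Conversely, in the triangle `j_! j^* X → X → i_* i^* X → ` the outer terms
are values of left adjoints, so maps from them to `Y[i]` correspond to maps into `(j^* Y)[i]` and
`(i^! Y)[i]`, which vanish for large `i`.

The equivalences form a cycle. Bounded complexes of `n`-projectives are left orthogonal to `n`-exact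
complexes, so maps out of them in `Db R n` are homotopy classes and vanish for degree reasons; the
eventually zero objects form a triangulated subcategory, and if `Dsg` vanishes they exhaust `Db R
n`. If all objects are eventually zero, the dimensions of modules are uniformly bounded
(`exists_nDimLE_of_eventuallyZero`): otherwise nonzero maps `M_m → Y_m[m+1]` exist for every `m`,
and all of them survive between the two coproducts `∐ M` and `∐ Y`. A uniform bound puts every stalk
complex, hence every bounded complex, in the image of `K^b(𝒫_n)`, so `Dsg` vanishes.

The syzygy-wise bound `NDimLE` agrees with `NPdLE`: dimension shifting gives one direction, iterated
mapping cones the other. -/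

lemma shortExact_map_homFunctor_iff {S : ShortComplex (ModuleCat.{u} R)} (hS : S.ShortExact)
    (M : ModuleCat.{u} R) :
    (S.map (homFunctor M)).ShortExact ↔ ∀ g : M ⟶ S.X₃, ∃ l : M ⟶ S.X₂, l ≫ S.g = g := by
  have := hS.mono_f
  constructor
  · intro h g
    have hepi := h.epi_g
    rw [AddCommGrpCat.epi_iff_surjective] at hepi
    exact hepi g
  · intro h
    have hepi : Epi (S.map (homFunctor M)).g := by
      rw [AddCommGrpCat.epi_iff_surjective]
      exact h
    have hmono : Mono (S.map (homFunctor M)).f :=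
      inferInstanceAs (Mono ((homFunctor M).map S.f))
    exact { exact := hS.exact.map_of_mono_of_preservesKernel _ inferInstance inferInstance }

lemma nProjective_iff (M : ModuleCat.{u} R) :
    NProjective n M ↔ ∀ S : ShortComplex (ModuleCat.{u} R), NShortExact n S →
      ∀ g : M ⟶ S.X₃, ∃ l : M ⟶ S.X₂, l ≫ S.g = g :=
  forall₂_congr fun _ hS => shortExact_map_homFunctor_iff hS.1 M

variable {n}

lemma FinProjClass.nProjective {M : ModuleCat.{u} R} (hM : FinProjClass R n M) :
    NProjective n M := fun _ hS => hS.2 M hM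

lemma NProjective.of_retract {M P : ModuleCat.{u} R} (hP : NProjective n P) (i : M ⟶ P)
    (r : P ⟶ M) (h : i ≫ r = 𝟙 M) : NProjective n M := by
  rw [nProjective_iff] at hP ⊢
  intro S hS g
  obtain ⟨l, hl⟩ := hP S hS (r ≫ g)
  exact ⟨i ≫ l, by rw [Category.assoc, hl, reassoc_of% h]⟩

lemma NProjective.of_iso {M P : ModuleCat.{u} R} (e : P ≅ M) (hP : NProjective n P) :
    NProjective n M := hP.of_retract e.inv e.hom e.inv_hom_id

lemma nProjective_of_isZero {M : ModuleCat.{u} R} (hM : IsZero M) : NProjective n M := by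
  rw [nProjective_iff]
  exact fun S _ g => ⟨0, hM.eq_of_src _ _⟩

lemma nProjective_biprod {P Q : ModuleCat.{u} R} (hP : NProjective n P) (hQ : NProjective n Q) :
    NProjective n (P ⊞ Q) := by
  rw [nProjective_iff] at hP hQ ⊢
  intro S hS g
  obtain ⟨l, hl⟩ := hP S hS (biprod.inl ≫ g)
  obtain ⟨l', hl'⟩ := hQ S hS (biprod.inr ≫ g)
  exact ⟨biprod.desc l l', biprod.hom_ext' _ _ (by simp [hl]) (by simp [hl'])⟩

lemma nProjective_sigma {J : Type u} (F : J → ModuleCat.{u} R) (hF : ∀ j, NProjective n (F j)) :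
    NProjective n (∐ F) := by
  rw [nProjective_iff]
  intro S hS g
  choose l hl using fun j => (nProjective_iff n _).1 (hF j) S hS (Sigma.ι F j ≫ g)
  exact ⟨Sigma.desc l, Sigma.hom_ext _ _ fun j => by simp [hl]⟩

lemma HasFGProjRes.finite {k : ℕ} {M : ModuleCat.{u} R} (h : HasFGProjRes R k M) :
    Module.Finite R M := by
  cases h with
  | zero _ hfin _ => exact hfin
  | succ k S hS hfin _ _ =>
    exact Module.Finite.of_surjective S.g.hom hS.moduleCat_surjective_g

variable (n)

/-- Every module has an `n`-projective cover map which is part of an `n`-exact sequence. -/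
lemma exists_nProjective_presentation (M : ModuleCat.{u} R) :
    ∃ (K P : ModuleCat.{u} R) (f : K ⟶ P) (g : P ⟶ M) (w : f ≫ g = 0),
      NShortExact n (ShortComplex.mk f g w) ∧ NProjective n P := by
  -- Quotients of the `R^k` represent all finitely generated modules by a set, so a single
  -- coproduct, over the `n`-projective ones and all their maps to `M`, receives every map from
  -- `𝒫^{<n+1}`.
  let Q : (Σ k : ℕ, Submodule R (Fin k → R)) → ModuleCat.{u} R :=
    fun i => ModuleCat.of R ((Fin i.1 → R) ⧸ i.2)
  let J := Σ i : {i // NProjective n (Q i)}, (Q i.1 ⟶ M)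
  let F : J → ModuleCat.{u} R := fun j => Q j.1.1
  let g : ∐ F ⟶ M := Sigma.desc fun j => j.2
  have lift (N : ModuleCat.{u} R) (hN : FinProjClass R n N) (x : N ⟶ M) :
      ∃ l : N ⟶ ∐ F, l ≫ g = x := by
    obtain ⟨k, -, hk⟩ := id hN
    have := hk.finite
    obtain ⟨m, p, hp⟩ := Module.Finite.exists_fin' R N
    let e : Q ⟨m, LinearMap.ker p⟩ ≅ N := (p.quotKerEquivOfSurjective hp).toModuleIso
    let j : J := ⟨⟨⟨m, LinearMap.ker p⟩, hN.nProjective.of_iso e.symm⟩, e.hom ≫ x⟩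
    refine ⟨e.inv ≫ Sigma.ι F j, ?_⟩
    rw [Category.assoc, Sigma.ι_desc]
    exact e.inv_hom_id_assoc x
  have hepi : Epi g := by
    rw [ModuleCat.epi_iff_surjective]
    intro y
    obtain ⟨l, hl⟩ := lift _ (finProjClass_self n)
      (ModuleCat.ofHom (LinearMap.toSpanSingleton R _ y))
    refine ⟨l.hom (1 : R), ?_⟩
    exact (congrArg (fun f => f.hom (1 : R)) hl).trans (one_smul R y)
  have hS : (ShortComplex.mk (kernel.ι g) g (kernel.condition g)).ShortExact :=
    { exact := ShortComplex.exact_of_f_is_kernel _ (kernelIsKernel g) }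
  exact ⟨kernel g, ∐ F, kernel.ι g, g, kernel.condition g,
    ⟨hS, fun N hN => (shortExact_map_homFunctor_iff hS N).2 (lift N hN)⟩,
    nProjective_sigma F fun j => j.1.2⟩

/-- `M` has an `n`-projective resolution of length at most `m`, built one syzygy at a time. -/
inductive NDimLE : ℕ → ModuleCat.{u} R → Prop
  | zero (M : ModuleCat.{u} R) (hM : NProjective n M) : NDimLE 0 M
  | succ (m : ℕ) (S : ShortComplex (ModuleCat.{u} R)) (hS : NShortExact n S)
      (hP : NProjective n S.X₂) (hK : NDimLE m S.X₁) : NDimLE (m + 1) S.X₃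

end Modules

/-! ### Orthogonality to `n`-exact complexes in the homotopy category. -/

section HomotopyCategory

variable {R : Type u} [Ring R] {n : ℕ∞}

-- `n`-exactness is acyclicity of every `Hom_R(M, -)`, and these functors are triangulated, so the
-- cone condition can be tested after applying each of them.
variable (n) in
lemma nExact_trW_iff {X Y : KCat R} (f : X ⟶ Y) : (nExact R n).trW f ↔
    ∀ M : ModuleCat.{u} R, FinProjClass R n M →
      HomotopyCategory.quasiIso AddCommGrpCat.{u} (ComplexShape.up ℤ)
        (((homFunctor M).mapHomotopyCategory (ComplexShape.up ℤ)).map f) := by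
  obtain ⟨Z, g, h, hT⟩ := distinguished_cocone_triangle f
  refine ((nExact R n).trW_iff_of_distinguished _ hT).trans ((nExact_prop_iff R n Z).trans
    (forall₂_congr fun M _ => ?_))
  rw [HomotopyCategory.quasiIso_eq_trW_subcategoryAcyclic]
  exact ((HomotopyCategory.subcategoryAcyclic AddCommGrpCat.{u}).trW_iff_of_distinguished _
    (((homFunctor M).mapHomotopyCategory (ComplexShape.up ℤ)).map_distinguished _ hT)).symm

lemma NShortExact.trW_quotient_map_descShortComplex {S : ShortComplex (ModuleCat.{u} R)}
    (hS : NShortExact n S) :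
    (nExact R n).trW ((HomotopyCategory.quotient _ _).map
      (CochainComplex.mappingCone.descShortComplex
        (S.map (CochainComplex.singleFunctor (ModuleCat.{u} R) 0)))) := by
  rw [nExact_trW_iff]
  intro M hM
  let S' := (S.map (CochainComplex.singleFunctor (ModuleCat.{u} R) 0)).map
    ((homFunctor M).mapHomologicalComplex (ComplexShape.up ℤ))
  have hS' : S'.ShortExact :=
    ShortComplex.shortExact_of_iso (S.mapNatIso
      (HomologicalComplex.singleMapHomologicalComplex (homFunctor M) (ComplexShape.up ℤ) 0)).symm
      ((hS.2 M hM).map_of_exact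
        (HomologicalComplex.single AddCommGrpCat.{u} (ComplexShape.up ℤ) 0))
  have h : QuasiIso (((homFunctor M).mapHomologicalComplex (ComplexShape.up ℤ)).map
      (CochainComplex.mappingCone.descShortComplex
        (S.map (CochainComplex.singleFunctor (ModuleCat.{u} R) 0)))) := by
    rw [← CochainComplex.mappingCone.mapHomologicalComplexIso_hom_descShortComplex]
    have : QuasiIso (CochainComplex.mappingCone.descShortComplex
        ((S.map (CochainComplex.singleFunctor (ModuleCat.{u} R) 0)).map
          ((homFunctor M).mapHomologicalComplex (ComplexShape.up ℤ)))) :=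
      CochainComplex.mappingCone.quasiIso_descShortComplex hS'
    have aux {X Y Z : CochainComplex AddCommGrpCat.{u} ℤ} (e : X ≅ Y) (f : Y ⟶ Z)
        (hf : QuasiIso f) : QuasiIso (e.hom ≫ f) := inferInstance
    exact aux _ _ this
  exact (HomotopyCategory.quotient_map_mem_quasiIso_iff _).2 h

/-- The `n`-exact sequence `S` yields an `n`-quasi-isomorphism from any cone of `S.f`. -/
lemma NShortExact.exists_trW {S : ShortComplex (ModuleCat.{u} R)} (hS : NShortExact n S)
    {Z : KCat R} (g : (HomotopyCategory.singleFunctor _ 0).obj S.X₂ ⟶ Z)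
    (h : Z ⟶ ((HomotopyCategory.singleFunctor _ 0).obj S.X₁)⟦(1 : ℤ)⟧)
    (hT : Triangle.mk ((HomotopyCategory.singleFunctor _ 0).map S.f) g h ∈ distTriang _) :
    ∃ t : Z ⟶ (HomotopyCategory.singleFunctor _ 0).obj S.X₃,
      g ≫ t = (HomotopyCategory.singleFunctor _ 0).map S.g ∧ (nExact R n).trW t := by
  let S' := S.map (CochainComplex.singleFunctor (ModuleCat.{u} R) 0)
  let e := isoTriangleOfIso₁₂ _ _ hT
    (HomotopyCategory.mappingCone_triangleh_distinguished S'.f)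
    (Iso.refl _) (Iso.refl _) ((Category.comp_id _).trans (Category.id_comp _).symm)
  let e₃ : Z ≅ (HomotopyCategory.quotient _ _).obj (CochainComplex.mappingCone S'.f) :=
    Triangle.π₃.mapIso e
  have he₃ : g ≫ e₃.hom = (HomotopyCategory.quotient _ _).map
      (CochainComplex.mappingCone.inr S'.f) := e.hom.comm₂.trans (Category.id_comp _)
  let d : (HomotopyCategory.quotient _ _).obj (CochainComplex.mappingCone S'.f) ⟶
      (HomotopyCategory.singleFunctor _ 0).obj S.X₃ :=
    (HomotopyCategory.quotient _ _).map (CochainComplex.mappingCone.descShortComplex S')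
  refine ⟨e₃.hom ≫ d, ?_, ?_⟩
  · rw [reassoc_of% he₃]
    exact (Functor.map_comp _ _ _).symm.trans
      (congrArg _ (CochainComplex.mappingCone.inr_descShortComplex S'))
  · exact MorphismProperty.RespectsIso.precomp _ _ _ hS.trW_quotient_map_descShortComplex

/-- A complex `Hom_R(P, X)` is acyclic when `P` is `n`-projective and `X` is `n`-exact. -/
lemma NExact.homCx_acyclic {X : CochainComplex (ModuleCat.{u} R) ℤ} (hX : NExact n X)
    {P : ModuleCat.{u} R} (hP : NProjective n P) : (homCx P X).Acyclic := by
  intro j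
  rw [homCx_exactAt_iff P X (j - 1) j (j + 1) (by omega) rfl]
  intro x hx
  obtain ⟨hi, w, hS⟩ := hX (j - 1)
  obtain ⟨hj, -⟩ := hX j
  -- Exactness at `j - 1` and `j` identifies `Coker d^{j-2}` with `Ker d^j`, so `x` lifts through
  -- the `n`-exact sequence at `j - 1`.
  have e1 : Epi (X.toCycles (j - 1) j) := by
    rw [HomologicalComplex.exactAt_iff_isZero_homology] at hj
    exact Preadditive.epi_of_isZero_cokernel' _ (X.homologyIsCokernel (j - 1) j (by simp)) hj
  have e2 : Mono (X.fromOpcycles (j - 1) j) := by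
    rw [HomologicalComplex.exactAt_iff_isZero_homology] at hi
    exact Preadditive.mono_of_isZero_kernel' _ (X.homologyIsKernel (j - 1) j (by simp)) hi
  have e3 : Epi (X.opcyclesToCycles (j - 1) j) := by
    have : Epi (X.pOpcycles (j - 1) ≫ X.opcyclesToCycles (j - 1) j) := by
      rwa [X.pOpcycles_opcyclesToCycles]
    exact epi_of_epi (X.pOpcycles (j - 1)) _
  have e4 : Mono (X.opcyclesToCycles (j - 1) j) := by
    have : Mono (X.opcyclesToCycles (j - 1) j ≫ X.iCycles j) := by
      rwa [X.opcyclesToCycles_iCycles]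
    exact mono_of_mono _ (X.iCycles j)
  have e5 : IsIso (X.opcyclesToCycles (j - 1) j) := isIso_of_mono_of_epi _
  obtain ⟨y, hy⟩ := (nProjective_iff n P).1 hP _ hS
    (X.liftCycles x (j + 1) (by simp) hx ≫ inv (X.opcyclesToCycles (j - 1) j))
  refine ⟨y, ?_⟩
  dsimp at y hy
  rw [← X.pOpcycles_opcyclesToCycles_iCycles (j - 1) j, reassoc_of% hy,
    IsIso.inv_hom_id_assoc, X.liftCycles_i]

open CochainComplex in
/-- Vanishing of maps in the homotopy category is acyclicity of the Hom complex. -/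
lemma homComplex_acyclic_iff (P Y : CochainComplex (ModuleCat.{u} R) ℤ) :
    (HomComplex P Y).Acyclic ↔ ∀ (i : ℤ)
      (f : (HomotopyCategory.quotient _ _).obj P ⟶
        (HomotopyCategory.quotient _ _).obj (Y⟦i⟧)), f = 0 := by
  refine forall_congr' fun i => ?_
  rw [HomologicalComplex.exactAt_iff_isZero_homology, AddCommGrpCat.isZero_iff_subsingleton,
    ((HomComplex.homologyAddEquiv P Y i).trans
      HomComplex.CohomologyClass.homAddEquiv).toEquiv.subsingleton_congr]
  exact ⟨fun h f => Subsingleton.elim _ _, fun h => ⟨fun a b => (h a).trans (h b).symm⟩⟩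

lemma leftOrthogonal_nExact_iff (P : CochainComplex (ModuleCat.{u} R) ℤ) :
    (nExact R n).leftOrthogonal ((HomotopyCategory.quotient _ _).obj P) ↔
      ∀ Y : CochainComplex (ModuleCat.{u} R) ℤ, NExact n Y →
        (CochainComplex.HomComplex P Y).Acyclic := by
  refine ⟨fun h Y hY => (homComplex_acyclic_iff P Y).2 fun i f => h f ?_, fun h Y f hY => ?_⟩
  · exact ObjectProperty.prop_of_iso _
      (((HomotopyCategory.quotient _ (ComplexShape.up ℤ)).commShiftIso i).symm.app Y)
      ((nExact R n).le_shift i ((HomotopyCategory.quotient _ _).obj Y) hY)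
  · let e := (HomotopyCategory.quotient _ (ComplexShape.up ℤ)).mapIso
      ((shiftFunctorZero (CochainComplex (ModuleCat.{u} R) ℤ) ℤ).app Y.as)
    have := (homComplex_acyclic_iff P Y.as).1 (h _ hY) 0 (f ≫ e.inv)
    exact (cancel_mono e.inv).1 (this.trans zero_comp.symm)

-- Cocycles out of a stalk complex are maps `P ⟶ Y^{p+i}` killed by the differential; they are
-- coboundaries because `Hom_R(P, Y)` is acyclic.
open CochainComplex HomComplex in
lemma NProjective.leftOrthogonal_single {P : ModuleCat.{u} R} (hP : NProjective n P) (p : ℤ) :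
    (nExact R n).leftOrthogonal ((HomotopyCategory.quotient _ _).obj
      ((CochainComplex.singleFunctor _ p).obj P)) := by
  rw [leftOrthogonal_nExact_iff]
  intro Y hY i
  rw [HomologicalComplex.exactAt_iff_isZero_homology, AddCommGrpCat.isZero_iff_subsingleton,
    (homologyAddEquiv _ Y i).toEquiv.subsingleton_congr]
  refine subsingleton_of_forall_eq 0 fun x => ?_
  obtain ⟨x, rfl⟩ := x.mk_surjective
  obtain ⟨f, hf, rfl⟩ := Cocycle.fromSingleMk_surjective x _ rfl _ rfl
  rw [CohomologyClass.mk_eq_zero_iff,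
    Cocycle.fromSingleMk_mem_coboundaries_iff _ _ _ _ _ (p + i - 1) (by omega)]
  exact (homCx_exactAt_iff P Y _ _ _ (by omega) rfl).1 (hY.homCx_acyclic hP (p + i)) f hf

/-- Maps in the homotopy category between complexes with disjoint supports vanish. -/
lemma quotient_hom_eq_zero {X Y : CochainComplex (ModuleCat.{u} R) ℤ}
    (h : ∀ i, IsZero (X.X i) ∨ IsZero (Y.X i))
    (f : (HomotopyCategory.quotient _ (ComplexShape.up ℤ)).obj X ⟶
      (HomotopyCategory.quotient _ (ComplexShape.up ℤ)).obj Y) : f = 0 := by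
  obtain ⟨f, rfl⟩ := (HomotopyCategory.quotient _ _).map_surjective f
  have : f = 0 := by
    ext1 i
    rcases h i with h | h
    · exact h.eq_of_src _ _
    · exact h.eq_of_tgt _ _
  rw [this, Functor.map_zero]

lemma hom_shift_eq_zero {X Y : KCat R} {a b i : ℤ} (hX : ∀ j < a, IsZero (X.as.X j))
    (hY : ∀ j > b, IsZero (Y.as.X j)) (hi : b < a + i) (f : X ⟶ Y⟦i⟧) : f = 0 := by
  let e := ((HomotopyCategory.quotient _ (ComplexShape.up ℤ)).commShiftIso i).symm.app Y.as
  refine (cancel_mono e.hom).1 ((quotient_hom_eq_zero (X := X.as) (Y := Y.as⟦i⟧) (fun j => ?_)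
    (f ≫ e.hom)).trans zero_comp.symm)
  by_cases hj : j < a
  · exact Or.inl (hX j hj)
  · exact Or.inr (hY (j + i) (by omega))

end HomotopyCategory

/-! ### Splittings and extensions in distinguished triangles. -/

section Triangles

variable {C : Type*} [Category* C] [HasZeroObject C] [HasShift C ℤ]
  [Preadditive C] [∀ k : ℤ, (shiftFunctor C k).Additive] [Pretriangulated C] {X Y Z : C}
  {f : X ⟶ Y} {g : Y ⟶ Z} {h : Z ⟶ X⟦(1 : ℤ)⟧}

lemma distinguished_of_iso_obj₃ (hT : Triangle.mk f g h ∈ distTriang C) {Z' : C} (t : Z ≅ Z') :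
    Triangle.mk f (g ≫ t.hom) (t.inv ≫ h) ∈ distTriang C := by
  refine isomorphic_distinguished _ hT _
    (Triangle.isoMk _ _ (Iso.refl _) (Iso.refl _) t.symm ?_ ?_ ?_)
  · exact (Category.comp_id f).trans (Category.id_comp f).symm
  · change (g ≫ t.hom) ≫ t.inv = 𝟙 Y ≫ g
    simp
  · change (t.inv ≫ h) ≫ (𝟙 X)⟦(1 : ℤ)⟧' = t.inv ≫ h
    simp

lemma exists_section_of_distinguished (hT : Triangle.mk f g h ∈ distTriang C) (h0 : h = 0) :
    ∃ r : Z ⟶ Y, r ≫ g = 𝟙 Z := by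
  obtain ⟨r, hr⟩ := Triangle.coyoneda_exact₃ _ hT (𝟙 Z) ((Category.id_comp _).trans h0)
  exact ⟨r, hr.symm⟩

lemma exists_extension_of_distinguished (hT : Triangle.mk f g h ∈ distTriang C)
    {A : C} (φ : X ⟶ A) (hφ : h ≫ φ⟦(1 : ℤ)⟧' = 0) :
    ∃ ψ : Y ⟶ A, f ≫ ψ = φ := by
  -- Rotating twice makes `h` the first map and `-f[1]` the second; this sign is why `-ψ` is the
  -- extension.
  obtain ⟨ψ, hψ⟩ := Triangle.yoneda_exact₂ _
    (rot_of_distTriang _ (rot_of_distTriang _ hT)) (φ⟦(1 : ℤ)⟧') hφ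
  replace hψ : φ⟦(1 : ℤ)⟧' = (-f⟦(1 : ℤ)⟧') ≫ ψ := hψ
  obtain ⟨ψ, rfl⟩ := (shiftFunctor C (1 : ℤ)).map_surjective (X := Y) (Y := A) ψ
  refine ⟨-ψ, (shiftFunctor C (1 : ℤ)).map_injective ?_⟩
  rw [hψ]
  simp

end Triangles

/-! ### Verdier quotients by `n`-exact complexes and dimension shifting. -/

section Relative

variable {R : Type u} [Ring R] (n : ℕ∞) (B : ObjectProperty (KCat R)) [B.IsTriangulated]

/-- The `n`-exact complexes in a triangulated subcategory `B` of the homotopy category. -/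
abbrev relExact : ObjectProperty B.FullSubcategory := (nExact R n).inverseImage B.ι

/-- The Verdier quotient of a triangulated subcategory `B` of the homotopy category by the
`n`-exact complexes in `B`. For bounded complexes, this is `D^b_n(R)`. -/
abbrev RelD := (relExact n B).trW.Localization

/-- The quotient functor to `RelD n B`. -/
abbrev relQ : B.FullSubcategory ⥤ RelD n B := (relExact n B).trW.Q

variable {n B}

lemma relQ_map_bijective {X : B.FullSubcategory} (hX : (nExact R n).leftOrthogonal X.obj)
    (Y : B.FullSubcategory) : Function.Bijective ((relQ n B).map : (X ⟶ Y) → _) := by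
  have hX' : (relExact n B).leftOrthogonal X := fun Y f hY =>
    B.ι.map_injective ((hX (B.ι.map f) hY).trans (B.ι.map_zero _ _).symm)
  exact hX'.map_bijective_of_isTriangulated _ Y

/-- Maps into a shift vanish in the Verdier quotient for degree reasons, if the source is
left orthogonal to the `n`-exact complexes. -/
lemma relQ_hom_shift_eq_zero {X Y : B.FullSubcategory}
    (hX : (nExact R n).leftOrthogonal X.obj) {a b i : ℤ}
    (ha : ∀ j < a, IsZero (X.obj.as.X j)) (hb : ∀ j > b, IsZero (Y.obj.as.X j)) (hi : b < a + i)
    (f : (relQ n B).obj X ⟶ ((relQ n B).obj Y)⟦i⟧) : f = 0 := by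
  let e := ((relQ n B).commShiftIso i).symm.app Y
  obtain ⟨g, hg⟩ := (relQ_map_bijective hX (Y⟦i⟧)).2 (f ≫ e.hom)
  have hg0 : g = 0 := by
    apply B.ι.map_injective
    let e' := (B.ι.commShiftIso i).app Y
    refine (cancel_mono e'.hom).1 ((hom_shift_eq_zero ha hb hi (B.ι.map g ≫ e'.hom)).trans ?_)
    rw [Functor.map_zero, zero_comp]
  refine (cancel_mono e.hom).1 (hg.symm.trans ?_)
  rw [hg0, Functor.map_zero, zero_comp]

lemma nExact_le_subcategoryAcyclic :
    nExact R n ≤ HomotopyCategory.subcategoryAcyclic (ModuleCat.{u} R) := fun X hX =>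
  (HomotopyCategory.quotient_obj_mem_subcategoryAcyclic_iff_exactAt X.as).2 fun i => (hX i).1

variable (n B) in
/-- The cohomology functor in degree `0` on `RelD n B`. -/
def relH : RelD n B ⥤ ModuleCat.{u} R :=
  Localization.lift (B.ι ⋙ HomotopyCategory.homologyFunctor _ (ComplexShape.up ℤ) 0)
    (W := (relExact n B).trW) (by
      intro X Y f hf
      rw [ObjectProperty.inverseImage_trW_iff] at hf
      have hf' := ObjectProperty.trW_monotone nExact_le_subcategoryAcyclic _ hf
      rw [← HomotopyCategory.quasiIso_eq_trW_subcategoryAcyclic] at hf'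
      exact hf' 0) (relQ n B)

variable (n) (hB : ∀ M, B ((HomotopyCategory.singleFunctor (ModuleCat.{u} R) 0).obj M))

/-- The functor sending a module to the complex concentrated in degree `0`. -/
abbrev relSingle : ModuleCat.{u} R ⥤ RelD n B :=
  B.lift (HomotopyCategory.singleFunctor (ModuleCat.{u} R) 0) hB ⋙ relQ n B

/-- The zeroth cohomology of a module is the module. -/
def relSingleHIso : relSingle n hB ⋙ relH n B ≅ 𝟭 _ :=
  Functor.associator _ _ _ ≪≫ Functor.isoWhiskerLeft _ (Localization.fac _ _ _) ≪≫
    (Functor.associator _ _ _).symm ≪≫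
    Functor.isoWhiskerRight (B.liftCompιIso _ hB) _ ≪≫
    Functor.isoWhiskerRight (HomotopyCategory.singleFunctorPostcompQuotientIso _ 0) _ ≪≫
    Functor.associator _ _ _ ≪≫
    Functor.isoWhiskerLeft _ (HomotopyCategory.homologyFunctorFactors _ _ 0) ≪≫
    HomologicalComplex.homologyFunctorSingleIso _ _ _

variable {n}

/-- The cone of `K → P` maps to `M` by an `n`-quasi-isomorphism, so in the quotient `M` can replace
the cone. -/
lemma NShortExact.exists_distinguished {K P M : ModuleCat.{u} R} {f : K ⟶ P} {g : P ⟶ M}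
    {w : f ≫ g = 0} (hS : NShortExact n (ShortComplex.mk f g w)) :
    ∃ δ : (relSingle n hB).obj M ⟶ ((relSingle n hB).obj K)⟦(1 : ℤ)⟧,
      Triangle.mk ((relSingle n hB).map f) ((relSingle n hB).map g) δ ∈ distTriang _ := by
  let S := ShortComplex.mk f g w
  let F := B.lift (HomotopyCategory.singleFunctor (ModuleCat.{u} R) 0) hB
  obtain ⟨Z, g, h, hT⟩ := distinguished_cocone_triangle (F.map S.f)
  obtain ⟨t, ht, htW⟩ := hS.exists_trW (B.ι.map g)
    (B.ι.map h ≫ (B.ι.commShiftIso (1 : ℤ)).hom.app _) (B.ι.map_distinguished _ hT)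
  obtain ⟨t, rfl⟩ := B.ι.map_surjective (X := Z) (Y := F.obj S.X₃) t
  have htg : g ≫ t = F.map S.g := B.ι.map_injective ((B.ι.map_comp _ _).trans ht)
  have htW' : (relExact n B).trW t := (ObjectProperty.inverseImage_trW_iff _ _ _).2 htW
  have := Localization.inverts (relQ n B) (relExact n B).trW t htW'
  have hT' : Triangle.mk ((relQ n B).map (F.map S.f)) ((relQ n B).map g)
      ((relQ n B).map h ≫ ((relQ n B).commShiftIso (1 : ℤ)).hom.app _) ∈ distTriang _ :=
    (relQ n B).map_distinguished _ hT
  have hT'' := distinguished_of_iso_obj₃ hT' (asIso ((relQ n B).map t))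
  rw [asIso_hom, ← Functor.map_comp, htg] at hT''
  exact ⟨_, hT''⟩

lemma isZero_singleFunctor_X {M : ModuleCat.{u} R} {j : ℤ} (hj : j ≠ 0) :
    IsZero (((HomotopyCategory.singleFunctor (ModuleCat.{u} R) 0).obj M).as.X j) :=
  HomologicalComplex.isZero_single_obj_X (ComplexShape.up ℤ) 0 M j hj

/-- If all extensions in degree `m + 1` vanish, then the `n`-projective dimension is at most `m`. -/
lemma nDimLE_of_hom_eq_zero (m : ℕ) (M : ModuleCat.{u} R)
    (h : ∀ (Y : ModuleCat.{u} R)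
      (φ : (relSingle n hB).obj M ⟶ ((relSingle n hB).obj Y)⟦(m + 1 : ℤ)⟧), φ = 0) :
    NDimLE n m M := by
  induction m generalizing M with
  | zero =>
    obtain ⟨K, P, f, g, w, hS, hP⟩ := exists_nProjective_presentation n M
    obtain ⟨δ, hδ⟩ := hS.exists_distinguished hB
    -- The class `δ` of the extension vanishes, so `P → M` splits in the quotient. Applying `H^0`
    -- turns the splitting into one of modules.
    obtain ⟨r, hr⟩ := exists_section_of_distinguished hδ (h K δ)
    let e := relSingleHIso n hB
    refine .zero _ (hP.of_retract (e.inv.app M ≫ (relH n B).map r ≫ e.hom.app P) g ?_)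
    have he : e.hom.app P ≫ g = (relH n B).map ((relSingle n hB).map g) ≫ e.hom.app M :=
      (e.hom.naturality g).symm
    rw [Category.assoc, Category.assoc, he, ← Functor.map_comp_assoc, hr,
      CategoryTheory.Functor.map_id, Category.id_comp]
    exact e.inv_hom_id_app M
  | succ m ih =>
    obtain ⟨K, P, f, g, w, hS, hP⟩ := exists_nProjective_presentation n M
    obtain ⟨δ, hδ⟩ := hS.exists_distinguished hB
    refine .succ m (ShortComplex.mk f g w) hS hP (ih K fun Y φ => ?_)
    -- This composite has degree `m + 2`, where all classes on `M` vanish. Hence `φ` extends to `P`,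
    -- which has no nonzero maps to `Y` in positive degree.
    have h₁ : δ ≫ φ⟦(1 : ℤ)⟧' = 0 := by
      let e := (shiftFunctorAdd' (RelD n B) (m + 1 : ℤ) 1 ((m + 1 : ℕ) + 1 : ℤ)
        (by simp)).symm.app ((relSingle n hB).obj Y)
      refine (cancel_mono e.hom).1 ((h Y ((δ ≫ φ⟦(1 : ℤ)⟧') ≫ e.hom)).trans zero_comp.symm)
    obtain ⟨ψ, rfl⟩ := exists_extension_of_distinguished hδ φ h₁
    have hψ0 : ψ = 0 := relQ_hom_shift_eq_zero (a := 0) (b := 0) (hP.leftOrthogonal_single 0)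
      (fun j hj => isZero_singleFunctor_X (by omega))
      (fun j hj => isZero_singleFunctor_X (by omega)) (by omega) ψ
    rw [hψ0, comp_zero]

end Relative

/-! ### Dévissage of bounded complexes to their terms. -/

section Devissage

variable {R : Type u} [Ring R] {n : ℕ∞}

lemma bounded_single (i : ℤ) (M : ModuleCat.{u} R) :
    bounded R ((HomotopyCategory.singleFunctor (ModuleCat.{u} R) i).obj M) :=
  ⟨i, i, fun j hj =>
    HomologicalComplex.isZero_single_obj_X (ComplexShape.up ℤ) i M j (by omega)⟩

variable (R) in
/-- The functor sending a module to the bounded complex concentrated in degree `i`. -/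
abbrev kbSingle (i : ℤ) : ModuleCat.{u} R ⥤ Kb R :=
  (bounded R).lift (HomotopyCategory.singleFunctor (ModuleCat.{u} R) i) (bounded_single i)

lemma isZero_kbSingle_obj (i : ℤ) {M : ModuleCat.{u} R} (hM : IsZero M) :
    IsZero ((kbSingle R i).obj M) := by
  rw [IsZero.iff_id_eq_zero]
  apply (bounded R).ι.map_injective
  exact (Functor.map_isZero (HomotopyCategory.singleFunctor (ModuleCat.{u} R) i) hM).eq_of_src _ _

/-- Removing the top degree term of a complex, as a degreewise split short exact sequence. -/
lemma exists_remove_top (X : CochainComplex (ModuleCat.{u} R) ℤ) (b : ℤ)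
    (hb : IsZero (X.X (b + 1))) :
    ∃ (X' : CochainComplex (ModuleCat.{u} R) ℤ)
      (f : (CochainComplex.singleFunctor _ b).obj (X.X b) ⟶ X) (g : X ⟶ X')
      (w : f ≫ g = 0)
      (_ : ∀ i, ((ShortComplex.mk f g w).map (HomologicalComplex.eval _ _ i)).Splitting),
      IsZero (X'.X b) ∧ ∀ i, i ≠ b → Nonempty (X.X i ≅ X'.X i) := by
  let f : (CochainComplex.singleFunctor _ b).obj (X.X b) ⟶ X :=
    HomologicalComplex.mkHomFromSingle (𝟙 _) (by
      rintro k rfl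
      exact hb.eq_of_tgt _ _)
  have hfb : IsIso (f.f b) := by
    have : f.f b = (HomologicalComplex.singleObjXSelf (ComplexShape.up ℤ) b (X.X b)).hom :=
      (HomologicalComplex.mkHomFromSingle_f _ _).trans (Category.comp_id _)
    rw [this]
    exact Iso.isIso_hom _
  have hz (i : ℤ) (hi : i ≠ b) : IsZero (((CochainComplex.singleFunctor _ b).obj (X.X b)).X i) :=
    HomologicalComplex.isZero_single_obj_X (ComplexShape.up ℤ) b _ i hi
  have hf : Mono f := by
    have (i : ℤ) : Mono (f.f i) := by
      by_cases hi : i = b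
      · subst hi
        infer_instance
      · exact ⟨fun _ _ _ => (hz i hi).eq_of_tgt _ _⟩
    exact HomologicalComplex.mono_of_mono_f f this
  let S := ShortComplex.mk f (cokernel.π f) (cokernel.condition f)
  have hS : S.ShortExact :=
    { exact := ShortComplex.exact_of_g_is_cokernel _ (cokernelIsCokernel f) }
  have hS' (i : ℤ) := hS.map_of_exact (HomologicalComplex.eval _ _ i)
  have hb' : IsZero ((cokernel f).X b) := by
    have h1 : (cokernel.π f).f b = 0 := by
      rw [← cancel_epi (f.f b), ← HomologicalComplex.comp_f, cokernel.condition]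
      simp
    have h2 : Epi ((cokernel.π f).f b) := (hS' b).epi_g
    exact IsZero.of_epi_eq_zero _ h1
  have hi' (i : ℤ) (hi : i ≠ b) : IsIso ((cokernel.π f).f i) := by
    have h1 : Epi ((cokernel.π f).f i) := (hS' i).epi_g
    have h2 : Mono ((cokernel.π f).f i) :=
      (hS' i).exact.mono_g ((hz i hi).eq_of_src _ _)
    exact isIso_of_mono_of_epi _
  refine ⟨cokernel f, f, cokernel.π f, cokernel.condition f, fun i => ?_, hb', fun i hi => ?_⟩
  · by_cases hi : i = b
    · subst hi
      exact .ofIsIsoOfIsZero _ hfb hb'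
    · exact .ofIsZeroOfIsIso _ (hz i hi) (hi' i hi)
  · have := hi' i hi
    exact ⟨asIso ((cokernel.π f).f i)⟩

/-- A bounded complex belongs to any extension-closed class of bounded complexes which contains
all of its terms. -/
lemma prop_of_bounded (p : ObjectProperty (Kb R)) [p.IsClosedUnderIsomorphisms]
    [p.IsTriangulatedClosed₂] [p.ContainsZero] (X : Kb R)
    (h : ∀ i, p ((kbSingle R i).obj (X.obj.as.X i))) : p X := by
  -- Induction on the length `k` of an interval `[a, a + k)` supporting the complex, peeling off
  -- degree `a + k` at each step. If the given bounds satisfy `b < a`, then `toNat` yields `k = 0`.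
  suffices H : ∀ (k : ℕ) (a : ℤ) (X : CochainComplex (ModuleCat.{u} R) ℤ)
      (_ : ∀ i, i < a ∨ a + k ≤ i → IsZero (X.X i)) (hX : IsBounded R X)
      (_ : ∀ i, p ((kbSingle R i).obj (X.X i))),
      p ⟨(HomotopyCategory.quotient _ _).obj X, hX⟩ by
    obtain ⟨X, a, b, hX⟩ := X
    exact H (b + 1 - a).toNat a X.as (fun i hi => hX i (by omega)) ⟨a, b, hX⟩ h
  intro k
  induction k with
  | zero =>
    intro a X hX hb _
    apply p.prop_of_isZero
    have hz : IsZero X := by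
      rw [IsZero.iff_id_eq_zero]
      ext1 i
      exact (hX i (by omega)).eq_of_src _ _
    rw [IsZero.iff_id_eq_zero]
    apply (bounded R).ι.map_injective
    exact (Functor.map_isZero (HomotopyCategory.quotient _ _) hz).eq_of_src _ _
  | succ k ih =>
    intro a X hX hb hp
    obtain ⟨X', f, g, w, σ, h₁, h₂⟩ := exists_remove_top X (a + k) (hX _ (by push_cast; omega))
    have hX' : ∀ i, i < a ∨ a + k ≤ i → IsZero (X'.X i) := by
      intro i hi
      by_cases hik : i = a + k
      · rwa [hik]
      · exact (hX i (by push_cast; omega)).of_iso (h₂ i hik).some.symm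
    have hb' : IsBounded R X' := ⟨a, a + k, fun i hi => hX' i (by omega)⟩
    have hp' : p ⟨(HomotopyCategory.quotient _ _).obj X', hb'⟩ := ih a X' hX' hb' fun i => by
      by_cases hik : i = a + k
      · exact p.prop_of_isZero (isZero_kbSingle_obj i (hik ▸ h₁))
      · exact p.prop_of_iso ((kbSingle R i).mapIso (h₂ i hik).some) (hp i)
    let XB : Kb R := ⟨(HomotopyCategory.quotient _ _).obj X, hb⟩
    let XB' : Kb R := ⟨(HomotopyCategory.quotient _ _).obj X', hb'⟩
    let fB : (kbSingle R (a + k)).obj (X.X (a + k)) ⟶ XB :=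
      ObjectProperty.homMk ((HomotopyCategory.quotient _ _).map f)
    obtain ⟨Z, u, v, hT⟩ := distinguished_cocone_triangle fB
    have hT' := (HomotopyCategory.distinguished_iff_iso_trianglehOfDegreewiseSplit _).2
      ⟨_, σ, ⟨Iso.refl _⟩⟩
    let e := isoTriangleOfIso₁₂ _ _ ((bounded R).ι.map_distinguished _ hT) hT'
      (Iso.refl _) (Iso.refl _) ((Category.comp_id _).trans (Category.id_comp _).symm)
    let e₃ : (bounded R).ι.obj Z ≅ (bounded R).ι.obj XB' := Triangle.π₃.mapIso e
    exact p.ext_of_isTriangulatedClosed₂ _ hT (hp (a + k))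
      (p.prop_of_iso ((bounded R).fullyFaithfulι.preimageIso e₃.symm) hp')

/-- Bounded complexes of `n`-projective modules are left orthogonal to `n`-exact complexes. -/
lemma KbProj.leftOrthogonal {X : Kb R} (hX : KbProj R n X) :
    (nExact R n).leftOrthogonal X.obj :=
  prop_of_bounded ((nExact R n).leftOrthogonal.inverseImage (bounded R).ι) X
    fun i => (hX i).leftOrthogonal_single i

end Devissage

/-! ### Objects whose maps into high shifts vanish. -/

section EventuallyZero

variable {C : Type*} [Category* C] [HasZeroObject C] [HasShift C ℤ]
  [Preadditive C] [∀ k : ℤ, (shiftFunctor C k).Additive] [Pretriangulated C]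

lemma isTriangulated_inverseImage {D : Type*} [Category* D] [HasZeroObject D] [HasShift D ℤ]
    [Preadditive D] [∀ k : ℤ, (shiftFunctor D k).Additive] [Pretriangulated D]
    (P : ObjectProperty C) (F : D ⥤ C) [F.CommShift ℤ] [F.IsTriangulated]
    [P.IsClosedUnderIsomorphisms] [P.IsTriangulated] : (P.inverseImage F).IsTriangulated :=
  inferInstance

variable (C) in
/-- The objects `X` such that for every `Y`, all maps from `X` to high shifts of `Y` vanish. -/
def eventuallyZero : ObjectProperty C :=
  fun X => ∀ Y : C, ∃ N : ℤ, ∀ i ≥ N, ∀ f : X ⟶ Y⟦i⟧, f = 0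

lemma eventuallyZero_of_distinguished {X₁ X₂ X₃ Y : C} {f : X₁ ⟶ X₂} {g : X₂ ⟶ X₃}
    {h : X₃ ⟶ X₁⟦(1 : ℤ)⟧} (hT : Triangle.mk f g h ∈ distTriang C)
    (h₁ : ∃ N : ℤ, ∀ i ≥ N, ∀ f : X₁ ⟶ Y⟦i⟧, f = 0)
    (h₃ : ∃ N : ℤ, ∀ i ≥ N, ∀ f : X₃ ⟶ Y⟦i⟧, f = 0) :
    ∃ N : ℤ, ∀ i ≥ N, ∀ f : X₂ ⟶ Y⟦i⟧, f = 0 := by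
  obtain ⟨N₁, h₁⟩ := h₁
  obtain ⟨N₃, h₃⟩ := h₃
  refine ⟨max N₁ N₃, fun i hi φ => ?_⟩
  obtain ⟨ψ, hψ⟩ := Triangle.yoneda_exact₂ _ hT φ (h₁ i (le_of_max_le_left hi) _)
  exact hψ.trans ((congrArg (g ≫ ·) (h₃ i (le_of_max_le_right hi) ψ)).trans comp_zero)

instance : (eventuallyZero C).IsClosedUnderIsomorphisms where
  of_iso e h Y := by
    obtain ⟨N, hN⟩ := h Y
    refine ⟨N, fun i hi f => ?_⟩
    rw [← cancel_epi e.hom, comp_zero]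
    exact hN i hi _

instance : (eventuallyZero C).IsTriangulated where
  exists_zero := ⟨0, isZero_zero C, fun Y => ⟨0, fun i _ f => (isZero_zero C).eq_of_src _ _⟩⟩
  isStableUnderShiftBy k :=
    { le_shift := by
        intro X hX Y
        obtain ⟨N, hN⟩ := hX Y
        refine ⟨N + k, fun i hi f => ?_⟩
        let e := (shiftFunctorAdd' C (i - k) k i (by omega)).app Y
        obtain ⟨g, hg⟩ := (shiftFunctor C k).map_surjective (X := X) (Y := Y⟦i - k⟧) (f ≫ e.hom)
        rw [hN (i - k) (by omega) g, Functor.map_zero] at hg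
        exact (cancel_mono e.hom).1 (hg.symm.trans zero_comp.symm) }
  toIsTriangulatedClosed₂ := .mk' fun T hT h₁ h₃ Y =>
    eventuallyZero_of_distinguished (Y := Y) hT (h₁ Y) (h₃ Y)

/-- The class `eventuallyZero C` is closed under the passage to objects killed in a Verdier
quotient. -/
lemma eventuallyZero_of_localization [IsTriangulated C] {P : ObjectProperty C}
    (hP : P ≤ eventuallyZero C) (h : ∀ X : P.trW.Localization, IsZero X) (X : C) :
    eventuallyZero C X := by
  let V := eventuallyZero C
  -- As `P ≤ V`, the quotient by `V` factors through the quotient by `P`, so `X` dies there too.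
  have hV : P.trW.IsInvertedBy V.trW.Q := fun A B f hf =>
    Localization.inverts V.trW.Q V.trW f (ObjectProperty.trW_monotone hP _ hf)
  let F := Localization.lift V.trW.Q hV P.trW.Q
  let ε : P.trW.Q ⋙ F ≅ V.trW.Q := Localization.fac _ hV _
  let e : V.trW.Q.obj X ≅ V.trW.Q.obj 0 :=
    ε.symm.app X ≪≫ F.mapIso ((h _).iso (h _)) ≪≫ ε.app 0
  have hz : IsZero (V.trW.Q.obj X) := (V.trW.Q.map_isZero (isZero_zero C)).of_iso e
  have h0 : V.trW.Q.map (𝟙 X) = V.trW.Q.map 0 := hz.eq_of_src _ _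
  -- Since `𝟙 X` becomes zero, some `s : Z ⟶ X` with cone `W` in `V` is itself zero. Every map out
  -- of `X` then factors through `W`.
  rw [MorphismProperty.map_eq_iff_precomp V.trW.Q V.trW] at h0
  obtain ⟨Z, s, ⟨W, g, k, hT, hW⟩, hs0⟩ := h0
  have hs : s = 0 := by simpa using hs0
  intro Y
  obtain ⟨N, hN⟩ := hW Y
  refine ⟨N, fun i hi φ => ?_⟩
  obtain ⟨ψ, hψ⟩ := Triangle.yoneda_exact₂ _ hT φ (by
    change s ≫ φ = 0
    rw [hs, zero_comp])
  exact hψ.trans ((congrArg (g ≫ ·) (hN i hi ψ)).trans comp_zero)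

end EventuallyZero

/-! ### Vanishing of the singularity category and uniform dimension bounds. -/

section Singularity

variable {R : Type u} [Ring R] {n : ℕ∞}

lemma NProjective.mappingCone_X {X Y : CochainComplex (ModuleCat.{u} R) ℤ} (f : X ⟶ Y)
    (hX : ∀ i, NProjective n (X.X i)) (hY : ∀ i, NProjective n (Y.X i)) (i : ℤ) :
    NProjective n ((CochainComplex.mappingCone f).X i) :=
  (nProjective_biprod (hX (i + 1)) (hY i)).of_iso
    (HomologicalComplex.homotopyCofiber.XIsoBiprod f i (i + 1) rfl).symm

/-- `KbProj` is a condition on the terms of a chosen complex and need not be homotopy invariant,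
hence the isomorphism closure. -/
instance : (KbProj R n).isoClosure.IsStableUnderShift ℤ where
  isStableUnderShiftBy m :=
    { le_shift := by
        rintro X ⟨Y, hY, ⟨e⟩⟩
        have hb : IsBounded R (Y.obj.as⟦m⟧) := by
          obtain ⟨a, b, h⟩ := Y.property
          exact ⟨a - m, b - m, fun i hi => h (i + m) (by omega)⟩
        let Z : Kb R := ⟨(HomotopyCategory.quotient _ _).obj (Y.obj.as⟦m⟧), hb⟩
        let e' : (bounded R).ι.obj (Y⟦m⟧) ≅ (bounded R).ι.obj Z :=
          ((bounded R).ι.commShiftIso m).app Y ≪≫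
            ((HomotopyCategory.quotient _ _).commShiftIso m).symm.app Y.obj.as
        exact ⟨Z, fun i => hY (i + m), ⟨(shiftFunctor _ m).mapIso e ≪≫
          (bounded R).fullyFaithfulι.preimageIso e'⟩⟩ }

instance : (KbProj R n).isoClosure.IsTriangulatedClosed₃ := .mk' <| by
  rintro T hT ⟨Y₁, h₁, ⟨e₁⟩⟩ ⟨Y₂, h₂, ⟨e₂⟩⟩
  obtain ⟨f : Y₁.obj.as ⟶ Y₂.obj.as, hf⟩ :=
    (HomotopyCategory.quotient _ _).map_surjective ((bounded R).ι.map (e₁.inv ≫ T.mor₁ ≫ e₂.hom))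
  have hb : IsBounded R (CochainComplex.mappingCone f) := by
    obtain ⟨a₁, b₁, h₁⟩ := Y₁.property
    obtain ⟨a₂, b₂, h₂⟩ := Y₂.property
    refine ⟨min (a₁ - 1) a₂, max (b₁ - 1) b₂, fun i hi => ?_⟩
    rw [CochainComplex.mappingCone.isZero_X_iff]
    exact ⟨h₁ _ (by omega), h₂ _ (by omega)⟩
  let Z : Kb R := ⟨(HomotopyCategory.quotient _ _).obj (CochainComplex.mappingCone f), hb⟩
  have comm : (bounded R).ι.map T.mor₁ ≫ (bounded R).ι.map e₂.hom =
      (bounded R).ι.map e₁.hom ≫ (bounded R).ι.map (e₁.inv ≫ T.mor₁ ≫ e₂.hom) := by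
    rw [← Functor.map_comp, ← Functor.map_comp, e₁.hom_inv_id_assoc]
  let e := isoTriangleOfIso₁₂ _ _ ((bounded R).ι.map_distinguished T hT)
      (HomotopyCategory.mappingCone_triangleh_distinguished f)
      ((bounded R).ι.mapIso e₁) ((bounded R).ι.mapIso e₂)
      (comm.trans (congrArg (_ ≫ ·) hf.symm))
  let e₃ : (bounded R).ι.obj T.obj₃ ≅ (bounded R).ι.obj Z := Triangle.π₃.mapIso e
  exact ⟨Z, NProjective.mappingCone_X f h₁ h₂, ⟨(bounded R).fullyFaithfulι.preimageIso e₃⟩⟩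

instance : (KbProj R n).isoClosure.IsTriangulated where
  exists_zero := ⟨(kbSingle R 0).obj 0, isZero_kbSingle_obj 0 (isZero_zero _),
    ObjectProperty.le_isoClosure _ _ fun i =>
      nProjective_of_isZero (Functor.map_isZero (HomologicalComplex.eval _ _ i)
        (Functor.map_isZero (CochainComplex.singleFunctor (ModuleCat.{u} R) 0) (isZero_zero _)))⟩
  toIsTriangulatedClosed₂ := .of_isTriangulatedClosed₃

/-- Fullness comes from left orthogonality. It makes the essential image triangulated, since maps
between its objects lift and so do their cones. -/
instance : ((KbProj R n).isoClosure.ι ⋙ Qb R n).Full where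
  map_surjective {X Y} f := by
    obtain ⟨W, hW, ⟨e⟩⟩ := X.property
    have hX : (nExact R n).leftOrthogonal X.obj.obj :=
      ObjectProperty.prop_of_iso _ ((bounded R).ι.mapIso e.symm) (KbProj.leftOrthogonal hW)
    obtain ⟨g, hg⟩ := (relQ_map_bijective (B := bounded R) (n := n) hX Y.obj).2 f
    exact ⟨ObjectProperty.homMk g, hg⟩

lemma map_KbProj_eq_essImage :
    (KbProj R n).map (Qb R n) = ((KbProj R n).isoClosure.ι ⋙ Qb R n).essImage := by
  ext X
  constructor
  · rintro ⟨Y, hY, ⟨e⟩⟩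
    exact ⟨⟨Y, ObjectProperty.le_isoClosure _ _ hY⟩, ⟨e⟩⟩
  · rintro ⟨⟨Y, Y', hY', ⟨e'⟩⟩, ⟨e⟩⟩
    exact ⟨Y', hY', ⟨(Qb R n).mapIso e'.symm ≪≫ e⟩⟩

instance : ((KbProj R n).map (Qb R n)).IsTriangulated := by
  rw [map_KbProj_eq_essImage]
  infer_instance

lemma map_KbProj_le_eventuallyZero :
    (KbProj R n).map (Qb R n) ≤ eventuallyZero (Db R n) := by
  rintro X ⟨W, hW, ⟨e⟩⟩
  refine ObjectProperty.prop_of_iso _ e fun Y => ?_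
  obtain ⟨Z, ⟨e'⟩⟩ : (Qb R n).essImage Y :=
    (Localization.essSurj (Qb R n) (KbExact R n).trW).mem_essImage Y
  obtain ⟨a, _, ha⟩ := W.property
  obtain ⟨_, b, hb⟩ := Z.property
  -- `W` lives in degrees at least `a` and `Z[i]` in degrees at most `b - i`; these are disjoint as
  -- soon as `i > b - a`.
  refine ⟨b - a + 1, fun i hi f => ?_⟩
  have := relQ_hom_shift_eq_zero (B := bounded R) (n := n) (KbProj.leftOrthogonal hW)
    (a := a) (b := b) (i := i) (fun j hj => ha j (Or.inl hj)) (fun j hj => hb j (Or.inr hj))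
    (by omega) (f ≫ (shiftFunctor _ i).map e'.inv)
  exact (cancel_mono ((shiftFunctor _ i).map e'.inv)).1 (this.trans zero_comp.symm)

/-- If the singularity category vanishes, then `Hom(X, Y[i])` vanishes for large `i`. -/
lemma eventuallyZero_of_isZero_Dsg (h : ∀ X : Dsg R n, IsZero X) (X : Db R n) :
    eventuallyZero (Db R n) X :=
  eventuallyZero_of_localization map_KbProj_le_eventuallyZero h X

/-- If `Hom(X, Y[i])` vanishes for large `i`, then the `n`-projective dimension of modules is
uniformly bounded. -/
lemma exists_nDimLE_of_eventuallyZero (h : ∀ X : Db R n, eventuallyZero (Db R n) X) :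
    ∃ m : ℕ, ∀ M : ModuleCat.{u} R, NDimLE n m M := by
  by_contra! hM
  choose M hM using hM
  let L := relSingle (B := bounded R) n (bounded_single 0)
  have hY : ∀ m : ℕ, ∃ (Y : ModuleCat.{u} R)
      (φ : L.obj (M m) ⟶ (L.obj Y)⟦(m + 1 : ℤ)⟧), φ ≠ 0 := by
    intro m
    by_contra! hY
    exact hM m (nDimLE_of_hom_eq_zero (bounded_single 0) m (M m) hY)
  choose Y φ hφ using hY
  -- One bound `N` for the two coproducts serves all `m` at once. Conjugating `φ m` by projections
  -- and inclusions gives a map between them from which `φ m` is recovered.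
  obtain ⟨N, hN⟩ := h (L.obj (∐ M)) (L.obj (∐ Y))
  let m := N.toNat
  have hm := hN (m + 1) (by omega)
    (L.map (Sigma.π M m) ≫ φ m ≫ (L.map (Sigma.ι Y m))⟦(m + 1 : ℤ)⟧')
  apply hφ m
  calc φ m = L.map (Sigma.ι M m) ≫ (L.map (Sigma.π M m) ≫ φ m ≫
        (L.map (Sigma.ι Y m))⟦(m + 1 : ℤ)⟧') ≫ (L.map (Sigma.π Y m))⟦(m + 1 : ℤ)⟧' := by
        simp only [Category.assoc, ← Functor.map_comp, ← Functor.map_comp_assoc,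
          Sigma.ι_π_eq_id, CategoryTheory.Functor.map_id, Category.comp_id, Category.id_comp]
    _ = 0 := by rw [hm, zero_comp, comp_zero]

/-- Each syzygy sequence becomes a triangle whose first two terms lie in the triangulated image of
`K^b(𝒫_n)`. -/
lemma NDimLE.map_KbProj {m : ℕ} {M : ModuleCat.{u} R} (h : NDimLE n m M) :
    (KbProj R n).map (Qb R n) ((Qb R n).obj ((kbSingle R 0).obj M)) := by
  have hproj {P : ModuleCat.{u} R} (hP : NProjective n P) :
      (KbProj R n).map (Qb R n) ((Qb R n).obj ((kbSingle R 0).obj P)) := by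
    refine ObjectProperty.prop_map_obj _ _ fun i => ?_
    by_cases hi : i = 0
    · subst hi
      exact hP.of_iso (HomologicalComplex.singleObjXSelf (ComplexShape.up ℤ) 0 P).symm
    · exact nProjective_of_isZero (isZero_singleFunctor_X hi)
  induction h with
  | zero M hM => exact hproj hM
  | succ m S hS hP _ ih =>
    obtain ⟨δ, hδ⟩ := NShortExact.exists_distinguished (B := bounded R) (bounded_single 0) hS
    exact ObjectProperty.ext_of_isTriangulatedClosed₃ _ _ hδ ih (hproj hP)

/-- If the `n`-projective dimension of modules is bounded, the singularity category vanishes. -/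
lemma isZero_Dsg_of_nDimLE {m : ℕ} (h : ∀ M : ModuleCat.{u} R, NDimLE n m M) (X : Dsg R n) :
    IsZero X := by
  let P := (KbProj R n).map (Qb R n)
  let p := P.inverseImage (Qb R n)
  have : p.IsTriangulated :=
    isTriangulated_inverseImage ((KbProj R n).map (Qb R n)) (Qb R n)
  -- By dévissage stalk complexes suffice, and a stalk in degree `i` is the shift by `-i` of one in
  -- degree `0`.
  have hp (X : Kb R) : p X := prop_of_bounded p X fun i => by
    let e := (HomotopyCategory.singleFunctors (ModuleCat.{u} R)).shiftIso (-i) i 0 (by omega)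
    let e' : ((kbSingle R 0).obj (X.obj.as.X i))⟦-i⟧ ≅ (kbSingle R i).obj (X.obj.as.X i) :=
      (bounded R).fullyFaithfulι.preimageIso
        (((bounded R).ι.commShiftIso (-i)).app _ ≪≫ e.app (X.obj.as.X i))
    exact p.prop_of_iso e' (p.le_shift (-i) _ (h _).map_KbProj)
  obtain ⟨Y, ⟨e⟩⟩ : P.trW.Q.essImage X :=
    (Localization.essSurj P.trW.Q P.trW).mem_essImage X
  obtain ⟨Z, ⟨e'⟩⟩ : (Qb R n).essImage Y :=
    (Localization.essSurj (Qb R n) (KbExact R n).trW).mem_essImage Y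
  have hY : P Y := P.prop_of_iso e' (hp Z)
  -- The cone of `0 ⟶ Y` is `Y`, which lies in `P`.
  have := Localization.inverts P.trW.Q P.trW (0 : 0 ⟶ Y)
    (ObjectProperty.trW.mk P (contractible_distinguished₁ Y) hY)
  exact (P.trW.Q.map_isZero (isZero_zero _)).of_iso
    (e.symm ≪≫ (asIso (P.trW.Q.map (0 : 0 ⟶ Y))).symm)

end Singularity

/-! ### Comparison with dimension defined by resolutions of complexes. -/

section GlobalDimension

variable {R : Type u} [Ring R] {n : ℕ∞}

lemma nQuasiIso_iff_trW {X Y : CochainComplex (ModuleCat.{u} R) ℤ} (f : X ⟶ Y) :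
    NQuasiIso n f ↔ (nExact R n).trW ((HomotopyCategory.quotient _ _).map f) :=
  ((nExact R n).trW_iff_of_distinguished _
    (HomotopyCategory.mappingCone_triangleh_distinguished f)).symm

/-- The resolution in `NPdLE` need not be bounded above, so it is compared with `M` in the quotient
of the whole homotopy category. -/
instance : (⊤ : ObjectProperty (KCat R)).IsTriangulated where
  exists_zero := ⟨0, isZero_zero _, trivial⟩
  isStableUnderShiftBy _ := { le_shift := fun _ _ => trivial }
  toIsTriangulatedClosed₂ := .mk' fun _ _ _ _ => trivial

/-- In the quotient `M` is isomorphic to its resolution `P`, which starts in degree `-m`.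
Orthogonality of `P` reduces maps to `Y[m+1]`, supported in degree `-(m+1)`, to homotopy classes,
and these vanish. -/
lemma NPdLE.nDimLE {M : ModuleCat.{u} R} {m : ℕ}
    (h : NPdLE n ((CochainComplex.singleFunctor (ModuleCat.{u} R) 0).obj M) m) :
    NDimLE n m M := by
  refine nDimLE_of_hom_eq_zero (B := ⊤) (fun _ => trivial) m M fun Y φ => ?_
  obtain ⟨P, f, hf, hP⟩ := h
  let PB : (⊤ : ObjectProperty (KCat R)).FullSubcategory :=
    ⟨(HomotopyCategory.quotient _ _).obj P, trivial⟩
  let MB := (ObjectProperty.lift (⊤ : ObjectProperty (KCat R))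
    (HomotopyCategory.singleFunctor (ModuleCat.{u} R) 0) (fun _ => trivial)).obj M
  let fB : PB ⟶ MB := ObjectProperty.homMk ((HomotopyCategory.quotient _ _).map f)
  have hfB : (relExact n (⊤ : ObjectProperty (KCat R))).trW fB :=
    (ObjectProperty.inverseImage_trW_iff _ _ _).2 ((nQuasiIso_iff_trW f).1 hf.quasiIso)
  have := Localization.inverts (relQ n ⊤) (relExact n (⊤ : ObjectProperty (KCat R))).trW fB hfB
  have h0 := relQ_hom_shift_eq_zero (B := ⊤) (X := PB) (a := -m) (b := 0) (i := m + 1)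
    ((leftOrthogonal_nExact_iff P).2 hf.hom_exact) (fun j hj => hP j hj)
    (fun j hj => isZero_singleFunctor_X (by omega)) (by omega)
    ((relQ n ⊤).map fB ≫ φ)
  exact (cancel_epi ((relQ n ⊤).map fB)).1 (h0.trans comp_zero.symm)

/-- A module of `n`-projective dimension at most `m` has a bounded resolution. -/
lemma NDimLE.exists_resolution {m : ℕ} {M : ModuleCat.{u} R} (h : NDimLE n m M) :
    ∃ (P : CochainComplex (ModuleCat.{u} R) ℤ)
      (f : P ⟶ (CochainComplex.singleFunctor (ModuleCat.{u} R) 0).obj M),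
      (nExact R n).trW ((HomotopyCategory.quotient _ _).map f) ∧
      (∀ i, NProjective n (P.X i)) ∧ ∀ i : ℤ, i < -m ∨ 0 < i → IsZero (P.X i) := by
  have hproj {P : ModuleCat.{u} R} (hP : NProjective n P) (i : ℤ) :
      NProjective n (((CochainComplex.singleFunctor (ModuleCat.{u} R) 0).obj P).X i) := by
    by_cases hi : i = 0
    · subst hi
      exact hP.of_iso (HomologicalComplex.singleObjXSelf (ComplexShape.up ℤ) 0 P).symm
    · exact nProjective_of_isZero (isZero_singleFunctor_X hi)
  induction h with
  | zero M hM =>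
    refine ⟨_, 𝟙 _, ?_, hproj hM, fun i hi => isZero_singleFunctor_X (by omega)⟩
    rw [CategoryTheory.Functor.map_id]
    exact MorphismProperty.id_mem _ _
  | succ m S hS hP _ ih =>
    obtain ⟨W, w, hw, hW, hW'⟩ := ih
    let s := CochainComplex.singleFunctor (ModuleCat.{u} R) 0
    let q := HomotopyCategory.quotient (ModuleCat.{u} R) (ComplexShape.up ℤ)
    -- The resolution of `S.X₃` is the cone of `W → S.X₁ → S.X₂`: it maps to the cone of `S.f` by
    -- `c`, then to `S.X₃` by `t`, and both maps have `n`-exact cones.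
    obtain ⟨c, hc, -, -⟩ := MorphismProperty.compatible_with_triangulation (W := (nExact R n).trW)
      (CochainComplex.mappingCone.triangleh (w ≫ s.map S.f))
      (CochainComplex.mappingCone.triangleh (s.map S.f))
      (HomotopyCategory.mappingCone_triangleh_distinguished _)
      (HomotopyCategory.mappingCone_triangleh_distinguished _)
      (q.map w) (𝟙 _) hw (MorphismProperty.id_mem _ _)
      ((Category.comp_id _).trans (q.map_comp _ _))
    obtain ⟨t, -, ht⟩ := hS.exists_trW _ _
      (HomotopyCategory.mappingCone_triangleh_distinguished (s.map S.f))
    obtain ⟨f, hf⟩ := q.map_surjective (X := CochainComplex.mappingCone (w ≫ s.map S.f))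
      (Y := s.obj S.X₃) (c ≫ t)
    refine ⟨_, f, ?_, NProjective.mappingCone_X _ hW (hproj hP), fun i hi => ?_⟩
    · have aux {A B : KCat R} {x y : A ⟶ B} (hxy : x = y) (hy : (nExact R n).trW y) :
          (nExact R n).trW x := hxy ▸ hy
      exact aux hf (MorphismProperty.comp_mem _ _ _ hc ht)
    · rw [CochainComplex.mappingCone.isZero_X_iff]
      push_cast at hi
      exact ⟨hW' _ (by omega), isZero_singleFunctor_X (by omega)⟩

lemma NDimLE.nPdLE {m : ℕ} {M : ModuleCat.{u} R} (h : NDimLE n m M) :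
    NPdLE n ((CochainComplex.singleFunctor (ModuleCat.{u} R) 0).obj M) m := by
  obtain ⟨P, f, hf, hP, hP'⟩ := h.exists_resolution
  let PB : Kb R := ⟨(HomotopyCategory.quotient _ _).obj P, -m, 0, hP'⟩
  have hPB : KbProj R n PB := hP
  exact ⟨P, f, ⟨(nQuasiIso_iff_trW f).2 hf, hP, (leftOrthogonal_nExact_iff P).1
    hPB.leftOrthogonal⟩, fun i hi => hP' i (Or.inl hi)⟩

lemma NPdLE.mono {X : CochainComplex (ModuleCat.{u} R) ℤ} {m m' : ℤ} (h : NPdLE n X m)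
    (hm : m ≤ m') : NPdLE n X m' := by
  obtain ⟨P, f, hf, hP⟩ := h
  exact ⟨P, f, hf, fun i hi => hP i (by omega)⟩

lemma nGldim_lt_top_iff :
    nGldim R n < ⊤ ↔ ∃ m : ℕ, ∀ M : ModuleCat.{u} R, NDimLE n m M := by
  constructor
  · intro h
    -- A strict bound lets the infimum defining `nPd` be witnessed by an actual resolution. A
    -- natural number is chosen even when the dimension is negative or `-∞`.
    obtain ⟨m, hm⟩ : ∃ m : ℕ, nGldim R n < ((m : ℤ) : WithTop ℤ) := by
      generalize nGldim R n = x at h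
      induction x with
      | bot => exact ⟨0, WithBot.bot_lt_coe _⟩
      | coe x =>
        induction x with
        | top => exact absurd h (lt_irrefl _)
        | coe x =>
          refine ⟨(x + 1).toNat, ?_⟩
          rw [WithBot.coe_lt_coe, WithTop.coe_lt_coe]
          omega
    refine ⟨m, fun M => ?_⟩
    have hM := (le_iSup (fun M : ModuleCat.{u} R =>
      nPd n ((CochainComplex.singleFunctor (ModuleCat.{u} R) 0).obj M)) M).trans_lt hm
    simp only [nPd, iInf_lt_iff] at hM
    obtain ⟨k, hk, hkm⟩ := hM
    rw [WithBot.coe_lt_coe, WithTop.coe_lt_coe] at hkm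
    exact (hk.mono hkm.le).nDimLE
  · rintro ⟨m, hm⟩
    refine lt_of_le_of_lt (b := (((m : ℤ) : WithTop ℤ) : WithBot (WithTop ℤ)))
      (iSup_le fun M => iInf₂_le (m : ℤ) (hm M).nPdLE) ?_
    exact WithBot.coe_lt_coe.2 (WithTop.coe_lt_top _)

lemma eventuallyZero_iff_exists_nDimLE :
    (∀ X : Db R n, eventuallyZero (Db R n) X) ↔
      ∃ m : ℕ, ∀ M : ModuleCat.{u} R, NDimLE n m M :=
  ⟨exists_nDimLE_of_eventuallyZero, fun ⟨_, h⟩ =>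
    eventuallyZero_of_isZero_Dsg (isZero_Dsg_of_nDimLE h)⟩

lemma isZero_Dsg_iff :
    (∀ X : Dsg R n, IsZero X) ↔ ∀ X : Db R n, eventuallyZero (Db R n) X :=
  ⟨eventuallyZero_of_isZero_Dsg, fun h => by
    obtain ⟨m, hm⟩ := exists_nDimLE_of_eventuallyZero h
    exact isZero_Dsg_of_nDimLE hm⟩

end GlobalDimension

/-! ### Transfer along recollements. -/

section Recollement

/-- Vanishing of high shifted maps transfers along an adjunction. -/
lemma eventuallyZero_of_adjunction {C D : Type*} [Category* C] [Category* D]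
    [HasShift C ℤ] [HasShift D ℤ] [Preadditive C] [Preadditive D] {F : C ⥤ D} {G : D ⥤ C} (adj : F ⊣ G)
    [G.CommShift ℤ]
    {X : C} {Y : D} (h : ∃ N : ℤ, ∀ i ≥ N, ∀ f : X ⟶ (G.obj Y)⟦i⟧, f = 0) :
    ∃ N : ℤ, ∀ i ≥ N, ∀ f : F.obj X ⟶ Y⟦i⟧, f = 0 := by
  obtain ⟨N, hN⟩ := h
  -- The right-hand side does not depend on `f`, so `f` and `0` have equal adjuncts; additivity of
  -- the adjunction bijection is not needed.
  have key (i : ℤ) (hi : i ≥ N) (f : F.obj X ⟶ Y⟦i⟧) :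
      adj.homEquiv _ _ f = 0 ≫ ((G.commShiftIso i).inv.app Y) := by
    rw [← hN i hi (adj.homEquiv _ _ f ≫ (G.commShiftIso i).hom.app Y), Category.assoc,
      Iso.hom_inv_id_app]
    exact (Category.comp_id _).symm
  exact ⟨N, fun i hi f => (adj.homEquiv _ _).injective ((key i hi f).trans (key i hi 0).symm)⟩

universe v₁ v₂ v₃ u₁ u₂ u₃

variable {T' : Type u₁} [Category.{v₁} T'] [HasZeroObject T'] [HasShift T' ℤ] [Preadditive T']
  [∀ k : ℤ, (shiftFunctor T' k).Additive] [Pretriangulated T']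
  {T : Type u₂} [Category.{v₂} T] [HasZeroObject T] [HasShift T ℤ] [Preadditive T]
  [∀ k : ℤ, (shiftFunctor T k).Additive] [Pretriangulated T]
  {T'' : Type u₃} [Category.{v₃} T''] [HasZeroObject T''] [HasShift T'' ℤ] [Preadditive T'']
  [∀ k : ℤ, (shiftFunctor T'' k).Additive] [Pretriangulated T'']

lemma eventuallyZero_of_faithful (F : T' ⥤ T) [F.CommShift ℤ] [F.IsTriangulated]
    [F.Faithful] (h : ∀ X : T, eventuallyZero T X) (X : T') : eventuallyZero T' X := by
  intro Y
  obtain ⟨N, hN⟩ := h (F.obj X) (F.obj Y)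
  refine ⟨N, fun i hi f => F.map_injective ?_⟩
  rw [Functor.map_zero, ← cancel_mono ((F.commShiftIso i).hom.app Y), zero_comp]
  exact hN i hi _

/-- For the converse the triangle with `j_!` and `i_*` is the right one: both are left adjoints, and
their right adjoints `j^*` and `i^!` commute with shifts. -/
lemma Recollement.eventuallyZero_iff (h : Recollement T' T T'') :
    (∀ X : T, eventuallyZero T X) ↔
      (∀ X : T', eventuallyZero T' X) ∧ ∀ X : T'', eventuallyZero T'' X := by
  let _ := h.iPushShift
  let _ := h.iShriekShift
  let _ := h.jShriekShift
  let _ := h.jPullShift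
  have := h.iPushTri
  have := h.jShriekTri
  have := h.iPush_faithful
  have := h.jShriek_faithful
  constructor
  · exact fun hT => ⟨eventuallyZero_of_faithful h.iPush hT,
      eventuallyZero_of_faithful h.jShriek hT⟩
  · rintro ⟨h', h''⟩ X Y
    obtain ⟨f, g, k, hT⟩ := h.triangle₂ X
    exact eventuallyZero_of_distinguished hT
      (eventuallyZero_of_adjunction h.adj₃ (h'' _ _))
      (eventuallyZero_of_adjunction h.adj₂ (h' _ _))

end Recollement

end NSing

end

theorem theorem4p6 (n : ℕ∞) (R S T : Type u) [Ring R] [Ring S] [Ring T]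
    (h : NSing.Recollement (NSing.Db S n) (NSing.Db R n) (NSing.Db T n)) :
    ((∀ X : NSing.Dsg R n, IsZero X) ↔
      (∀ X : NSing.Dsg S n, IsZero X) ∧ (∀ X : NSing.Dsg T n, IsZero X)) ∧
    (NSing.nGldim R n < ⊤ ↔ NSing.nGldim S n < ⊤ ∧ NSing.nGldim T n < ⊤) := by
  simp only [NSing.nGldim_lt_top_iff, ← NSing.eventuallyZero_iff_exists_nDimLE,
    NSing.isZero_Dsg_iff]
  exact ⟨h.eventuallyZero_iff, h.eventuallyZero_iff⟩
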